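/- Let $M$ be a $3$-dimensional smooth Riemannian manifold with metric connection (Levi-Civita connection) $\nabla$, and let $f\colon M\to\mathbb R$ be a smooth function. Write $f_i=\nabla_i f$ and $f_{ij}=\nabla_i\nabla_j f$, raise and lower indices with the metric, and denote contractions by repeated indices (so that $f^if_i=\|\nabla f\|^2$ and $f^j{}_j=\Delta f$). A smooth function $g\colon M\to\mathbb R$ is called conjugate to $f$ if, at every point of $M$, $$\|\nabla f\|=\|\nabla g\|\quad\text{and}\quad\langle\nabla f,\nabla g\rangle=0 .$$ If $f$ admits a conjugate, then at every point of $M$ $$X:=2f_i{}^jf_jf^{ik}f_k-f^if_if^{jk}f_{jk}+f^if_i(f^j{}_j)^2\leq 0 .$$ -/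

import Mathlib

open scoped Manifold ContDiff Bundle

noncomputable section

namespace RiemannianConjugate

section Gradient

variable {n : ℕ} {M : Type*} [TopologicalSpace M] [ChartedSpace (EuclideanSpace ℝ (Fin n)) M]
  [Bundle.RiemannianBundle (fun x : M => TangentSpace (𝓡 n) x)]

instance (x : M) : FiniteDimensional ℝ (TangentSpace (𝓡 n) x) :=
  inferInstanceAs (FiniteDimensional ℝ (EuclideanSpace ℝ (Fin n)))

instance (x : M) : CompleteSpace (TangentSpace (𝓡 n) x) :=
  FiniteDimensional.complete ℝ (TangentSpace (𝓡 n) x)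

variable (n) in
/-- The Riemannian gradient of `f` at `x`: the tangent vector representing the differential
`df` at `x` through the inner product on the tangent space at `x`. -/
def grad (f : M → ℝ) (x : M) : TangentSpace (𝓡 n) x :=
  (InnerProductSpace.toDual ℝ (TangentSpace (𝓡 n) x)).symm (mvfderiv (𝓡 n) f x)

variable (n) in
/-- Two smooth functions on a Riemannian manifold are conjugate if at every point their
gradients have the same length and are orthogonal. -/
structure IsConjugate (f g : M → ℝ) : Prop where
  smooth_left : ContMDiff (𝓡 n) 𝓘(ℝ) ∞ f
  smooth_right : ContMDiff (𝓡 n) 𝓘(ℝ) ∞ g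
  norm_grad_eq : ∀ x, ‖grad n f x‖ = ‖grad n g x‖
  inner_grad_eq_zero : ∀ x, inner ℝ (grad n f x) (grad n g x) = 0

end Gradient

/-- The partial derivative `∂ᵢ F` of a function on `ℝⁿ`. -/
def partialDeriv {n : ℕ} (i : Fin n) (F : EuclideanSpace ℝ (Fin n) → ℝ)
    (y : EuclideanSpace ℝ (Fin n)) : ℝ :=
  fderiv ℝ F y (EuclideanSpace.single i 1)

/-- The `i`-th standard basis vector of `ℝⁿ`, as a tangent vector to `ℝⁿ` at `y`. -/
def stdVec {n : ℕ} (y : EuclideanSpace ℝ (Fin n)) (i : Fin n) : TangentSpace (𝓡 n) y :=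
  (EuclideanSpace.single i 1 : EuclideanSpace ℝ (Fin n))

section Coordinates

variable {n : ℕ} {M : Type*} [TopologicalSpace M] [ChartedSpace (EuclideanSpace ℝ (Fin n)) M]
  [Bundle.RiemannianBundle (fun x : M => TangentSpace (𝓡 n) x)]
  (φ : OpenPartialHomeomorph M (EuclideanSpace ℝ (Fin n)))

/-- The coordinate vector field `∂/∂xⁱ` of the chart `φ`, at the point with coordinates `y`. -/
def coordVec (y : EuclideanSpace ℝ (Fin n)) (i : Fin n) : TangentSpace (𝓡 n) (φ.symm y) :=
  mfderiv (𝓡 n) (𝓡 n) φ.symm y (stdVec y i)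

/-- The components `g_{ij} = ⟨∂/∂xⁱ, ∂/∂xʲ⟩` of the metric in the chart `φ`. -/
def metricMatrix (y : EuclideanSpace ℝ (Fin n)) : Matrix (Fin n) (Fin n) ℝ :=
  fun i j => inner ℝ (coordVec φ y i) (coordVec φ y j)

/-- The components `g^{ij}` of the inverse metric in the chart `φ`. -/
def invMetric (y : EuclideanSpace ℝ (Fin n)) : Matrix (Fin n) (Fin n) ℝ :=
  (metricMatrix φ y)⁻¹

/-- The Christoffel symbols of the Levi-Civita connection in the chart `φ`,
`Γᵏᵢⱼ = ½ gᵏˡ (∂ᵢ gⱼₗ + ∂ⱼ gᵢₗ - ∂ₗ gᵢⱼ)`. -/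
def christoffel (y : EuclideanSpace ℝ (Fin n)) (k i j : Fin n) : ℝ :=
  1 / 2 * ∑ l, invMetric φ y k l *
    (partialDeriv i (fun z => metricMatrix φ z j l) y
      + partialDeriv j (fun z => metricMatrix φ z i l) y
      - partialDeriv l (fun z => metricMatrix φ z i j) y)

variable (f : M → ℝ)

/-- `f_i = ∇_i f`, the components of the differential of `f` in the chart `φ`. -/
def d1 (y : EuclideanSpace ℝ (Fin n)) (i : Fin n) : ℝ :=
  partialDeriv i (f ∘ φ.symm) y

/-- `f_{ij} = ∇_i ∇_j f = ∂ᵢ∂ⱼ f - Γᵏᵢⱼ ∂ₖ f`, the components of the second covariant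
derivative of `f` in the chart `φ`. -/
def d2 (y : EuclideanSpace ℝ (Fin n)) (i j : Fin n) : ℝ :=
  partialDeriv i (fun z => d1 φ f z j) y - ∑ k, christoffel φ y k i j * d1 φ f y k

/-- `f^i = g^{ia} f_a`. -/
def d1Up (y : EuclideanSpace ℝ (Fin n)) (i : Fin n) : ℝ :=
  ∑ a, invMetric φ y i a * d1 φ f y a

/-- `f_i^j = f_{ia} g^{aj}`. -/
def d2Mixed (y : EuclideanSpace ℝ (Fin n)) (i j : Fin n) : ℝ :=
  ∑ a, d2 φ f y i a * invMetric φ y a j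

/-- `f^{ij} = g^{ia} f_{ab} g^{bj}`. -/
def d2Up (y : EuclideanSpace ℝ (Fin n)) (i j : Fin n) : ℝ :=
  ∑ a, ∑ b, invMetric φ y i a * d2 φ f y a b * invMetric φ y b j

/-- The scalar `X = 2 f_i^j f_j f^{ik} f_k - f^i f_i f^{jk} f_{jk} + f^i f_i (f^j_j)²`, computed
in the chart `φ` at the point with coordinates `y`. -/
def X (y : EuclideanSpace ℝ (Fin n)) : ℝ :=
  2 * (∑ i, ∑ j, ∑ k, d2Mixed φ f y i j * d1 φ f y j * d2Up φ f y i k * d1 φ f y k)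
    - (∑ i, d1Up φ f y i * d1 φ f y i) * (∑ j, ∑ k, d2Up φ f y j k * d2 φ f y j k)
    + (∑ i, d1Up φ f y i * d1 φ f y i) * (∑ j, d2Mixed φ f y j j) ^ 2

end Coordinates

end RiemannianConjugate

end

/-! Differentiating the two conjugacy equations, with `∇` compatible with the metric, gives `f_{ki}
f^i = g_{ki} g^i` and `f_{ki} g^i = -g_{ki} f^i` (`partialDeriv_pairing`). Since the Hessian of `g`
is symmetric, pairing both with `∇g` and `∇f` eliminates it: `Hess f (∇g, ∇g) = -Hess f (∇f, ∇f)`.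

Where `∇f = 0`, `X` vanishes. Elsewhere complete `∇f, ∇g` to an orthogonal frame of vectors of
square length `l = ‖∇f‖²`, and let `T` be the matrix of `Hess f` in it. Then `l X = 2 ∑ T_{i0}² - tr
T² + (tr T)²`, and `T₁₁ = -T₀₀` collapses this to `-2 T₁₂²` (`conjugate_quadratic_nonpos`). The rest
translates between gradients on the manifold and matrices in a chart (`inner_grad_eq`, `X_eq`). -/

namespace RiemannianConjugate

/-! ### Linear algebra of the pointwise inequality. -/

section LinearAlgebra

open Matrix

/-- If the columns of `B` are `S`-orthogonal of common square length `c`, then `B Bᵀ = c S⁻¹`. -/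
lemma mul_transpose_eq_smul_inv {ι : Type*} [Fintype ι] [DecidableEq ι] {S B : Matrix ι ι ℝ}
    {c : ℝ} (hc : c ≠ 0) (h : Bᵀ * S * B = c • (1 : Matrix ι ι ℝ)) : B * Bᵀ = c • S⁻¹ := by
  have h1 : (c⁻¹ • (Bᵀ * S)) * B = 1 := by
    rw [smul_mul_assoc, h, smul_smul, inv_mul_cancel₀ hc, one_smul]
  have h2 := mul_eq_one_comm.mp h1
  have h3 : (c⁻¹ • (B * Bᵀ)) * S = 1 := by
    rw [← h2, mul_smul_comm, smul_mul_assoc, Matrix.mul_assoc]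
  rw [Matrix.inv_eq_left_inv h3, smul_smul, mul_inv_cancel₀ hc, one_smul]

/-- Two orthogonal vectors of the same nonzero length in a three-dimensional inner product space
extend to an orthogonal frame of vectors of this length. -/
lemma exists_frame {S : Matrix (Fin 3) (Fin 3) ℝ} (hS : S.PosDef) {U V : Fin 3 → ℝ}
    (hU : U ≠ 0) (hUV : U ⬝ᵥ S *ᵥ V = 0) (hV : V ⬝ᵥ S *ᵥ V = U ⬝ᵥ S *ᵥ U) :
    ∃ B : Matrix (Fin 3) (Fin 3) ℝ, B.col 0 = U ∧ B.col 1 = V ∧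
      Bᵀ * S * B = (U ⬝ᵥ S *ᵥ U) • (1 : Matrix (Fin 3) (Fin 3) ℝ) := by
  have hsymm : ∀ x y : Fin 3 → ℝ, x ⬝ᵥ S *ᵥ y = y ⬝ᵥ S *ᵥ x := fun x y => by
    have hT : Sᵀ = S := by
      rw [← conjTranspose_eq_transpose_of_trivial, hS.isHermitian.eq]
    rw [dotProduct_mulVec, ← mulVec_transpose, hT, dotProduct_comm]
  have hpos : ∀ x : Fin 3 → ℝ, x ≠ 0 → 0 < x ⬝ᵥ S *ᵥ x := fun x hx => by
    simpa using hS.dotProduct_mulVec_pos hx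
  -- The zero third row makes the matrix singular; a kernel vector is `S`-orthogonal to `U` and `V`.
  obtain ⟨W₀, hW₀, hW⟩ := (Matrix.exists_mulVec_eq_zero_iff
    (M := (Matrix.of ![S *ᵥ U, S *ᵥ V, 0] : Matrix (Fin 3) (Fin 3) ℝ))).2
    (det_eq_zero_of_row_eq_zero 2 fun j => by simp)
  have hW₀U : W₀ ⬝ᵥ S *ᵥ U = 0 := by
    rw [dotProduct_comm]; exact congrFun hW 0
  have hW₀V : W₀ ⬝ᵥ S *ᵥ V = 0 := by
    rw [dotProduct_comm]; exact congrFun hW 1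
  have hl := hpos U hU
  have hw := hpos W₀ hW₀
  set l := U ⬝ᵥ S *ᵥ U with hl_def
  set w := W₀ ⬝ᵥ S *ᵥ W₀ with hw_def
  set W := √(l / w) • W₀ with hW_def
  have hWU : W ⬝ᵥ S *ᵥ U = 0 := by rw [hW_def, smul_dotProduct, hW₀U, smul_zero]
  have hWV : W ⬝ᵥ S *ᵥ V = 0 := by rw [hW_def, smul_dotProduct, hW₀V, smul_zero]
  have hWW : W ⬝ᵥ S *ᵥ W = l := by
    rw [hW_def, mulVec_smul, smul_dotProduct, dotProduct_smul, ← hw_def, smul_eq_mul, smul_eq_mul,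
      ← mul_assoc, Real.mul_self_sqrt (by positivity), div_mul_cancel₀ _ hw.ne']
  refine ⟨(Matrix.of ![U, V, W])ᵀ, rfl, rfl, ?_⟩
  have key : ∀ i j, ((Matrix.of ![U, V, W])ᵀᵀ * S * (Matrix.of ![U, V, W])ᵀ) i j
      = ![U, V, W] i ⬝ᵥ S *ᵥ ![U, V, W] j := fun i j => by
    rw [Matrix.mul_assoc, transpose_transpose]
    rfl
  ext i j
  rw [key]
  fin_cases i <;> fin_cases j <;>
    simp [hsymm V U, hsymm U W, hsymm V W, hUV, hV, hWU, hWV, hWW, ← hl_def]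

/-- The algebraic core: the integrability conditions force the quadratic expression in the Hessian
`H` to be nonpositive. -/
lemma conjugate_quadratic_nonpos {S H K : Matrix (Fin 3) (Fin 3) ℝ} (hS : S.PosDef)
    (hH : Hᵀ = H) (hK : Kᵀ = K) {U V : Fin 3 → ℝ}
    (hUV : U ⬝ᵥ S *ᵥ V = 0) (hV : V ⬝ᵥ S *ᵥ V = U ⬝ᵥ S *ᵥ U)
    (h₁ : H *ᵥ U = K *ᵥ V) (h₂ : H *ᵥ V = -(K *ᵥ U)) :
    2 * ((H *ᵥ U) ⬝ᵥ S⁻¹ *ᵥ (H *ᵥ U)) - (U ⬝ᵥ S *ᵥ U) * (S⁻¹ * H * S⁻¹ * H).trace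
      + (U ⬝ᵥ S *ᵥ U) * (H * S⁻¹).trace ^ 2 ≤ 0 := by
  by_cases hU : U = 0
  · simp [hU]
  have hl : 0 < U ⬝ᵥ S *ᵥ U := by simpa using hS.dotProduct_mulVec_pos hU
  obtain ⟨B, hBU, hBV, hB⟩ := exists_frame hS hU hUV hV
  set l := U ⬝ᵥ S *ᵥ U
  have hQ := mul_transpose_eq_smul_inv hl.ne' hB
  set T := Bᵀ * H * B with hT_def
  have hTs : ∀ i j, T i j = T j i := fun i j => by
    have : Tᵀ = T := by rw [hT_def]; simp [hH, Matrix.mul_assoc]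
    exact congrFun (congrFun this j) i
  have hTij : ∀ i j, T i j = B.col i ⬝ᵥ H *ᵥ B.col j := fun i j => by
    rw [hT_def, Matrix.mul_assoc]
    rfl
  -- Both entries reduce to `U ⬝ᵥ K *ᵥ V` up to sign, by symmetry of `K`.
  have h11 : T 1 1 = - T 0 0 := by
    rw [hTij, hTij, hBU, hBV, h₂, h₁, dotProduct_neg, dotProduct_mulVec, ← mulVec_transpose, hK,
      dotProduct_comm]
  have htr : T.trace = l * (H * S⁻¹).trace := by
    rw [hT_def, Matrix.mul_assoc, trace_mul_comm, Matrix.mul_assoc, hQ, Matrix.mul_smul,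
      trace_smul, smul_eq_mul]
  have htr2 : (T * T).trace = l ^ 2 * (S⁻¹ * H * S⁻¹ * H).trace := by
    have : (T * T).trace = ((B * Bᵀ) * H * (B * Bᵀ) * H).trace := by
      rw [hT_def, trace_mul_comm ((B * Bᵀ) * H * (B * Bᵀ)) H]
      rw [show Bᵀ * H * B * (Bᵀ * H * B) = Bᵀ * (H * B * (Bᵀ * H * B)) by
        simp only [Matrix.mul_assoc], trace_mul_comm]
      simp only [Matrix.mul_assoc]
    rw [this, hQ]
    simp only [Matrix.smul_mul, Matrix.mul_smul, trace_smul, smul_eq_mul]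
    ring
  have hrow : ∑ i, T i 0 ^ 2 = l * ((H *ᵥ U) ⬝ᵥ S⁻¹ *ᵥ (H *ᵥ U)) := by
    have h0 : ∀ i, T i 0 = (Bᵀ *ᵥ (H *ᵥ U)) i := fun i => by
      rw [hTij, hBU]; rfl
    calc ∑ i, T i 0 ^ 2 = (Bᵀ *ᵥ (H *ᵥ U)) ⬝ᵥ (Bᵀ *ᵥ (H *ᵥ U)) := by
          simp only [h0, dotProduct, sq]
      _ = (H *ᵥ U) ⬝ᵥ (B * Bᵀ) *ᵥ (H *ᵥ U) := by
          rw [← mulVec_mulVec, dotProduct_mulVec (H *ᵥ U), ← mulVec_transpose]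
      _ = _ := by rw [hQ, smul_mulVec, dotProduct_smul, smul_eq_mul]
  -- In `2 ∑ T_{i0}² - tr T² + (tr T)²` one has `tr T = T₂₂`, so everything cancels except the entry
  -- `T₁₂`.
  have hfin : l * (2 * ((H *ᵥ U) ⬝ᵥ S⁻¹ *ᵥ (H *ᵥ U)) - l * (S⁻¹ * H * S⁻¹ * H).trace
      + l * (H * S⁻¹).trace ^ 2) = -(2 * T 1 2 ^ 2) := by
    have : l * (2 * ((H *ᵥ U) ⬝ᵥ S⁻¹ *ᵥ (H *ᵥ U)) - l * (S⁻¹ * H * S⁻¹ * H).trace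
      + l * (H * S⁻¹).trace ^ 2) = 2 * ∑ i, T i 0 ^ 2 - (T * T).trace + T.trace ^ 2 := by
      rw [hrow, htr, htr2]; ring
    rw [this]
    simp only [trace, diag, mul_apply, Fin.sum_univ_three]
    rw [hTs 1 0, hTs 2 0, hTs 2 1, h11]
    ring
  refine nonpos_of_mul_nonpos_right ?_ hl
  rw [hfin]
  nlinarith [sq_nonneg (T 1 2)]

end LinearAlgebra

end RiemannianConjugate

namespace RiemannianConjugate

/-! ### Partial derivatives and differentiability of the matrix inverse. -/

section Calculus

open Matrix Filter Topology

variable {n : ℕ} {y : EuclideanSpace ℝ (Fin n)}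

lemma partialDeriv_congr {F G : EuclideanSpace ℝ (Fin n) → ℝ} (h : F =ᶠ[𝓝 y] G) (k : Fin n) :
    partialDeriv k F y = partialDeriv k G y := by
  rw [partialDeriv, partialDeriv, h.fderiv_eq]

lemma partialDeriv_sum {ι : Type*} {s : Finset ι} {F : ι → EuclideanSpace ℝ (Fin n) → ℝ}
    (h : ∀ i ∈ s, DifferentiableAt ℝ (F i) y) (k : Fin n) :
    partialDeriv k (fun z => ∑ i ∈ s, F i z) y = ∑ i ∈ s, partialDeriv k (F i) y := by
  simp [partialDeriv, fderiv_fun_sum h]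

lemma partialDeriv_mul {F G : EuclideanSpace ℝ (Fin n) → ℝ}
    (hF : DifferentiableAt ℝ F y) (hG : DifferentiableAt ℝ G y) (k : Fin n) :
    partialDeriv k (fun z => F z * G z) y
      = F y * partialDeriv k G y + partialDeriv k F y * G y := by
  simp [partialDeriv, fderiv_fun_mul hF hG, mul_comm]

lemma partialDeriv_sum_mul {ι : Type*} [Fintype ι] {F G : ι → EuclideanSpace ℝ (Fin n) → ℝ}
    (hF : ∀ i, DifferentiableAt ℝ (F i) y) (hG : ∀ i, DifferentiableAt ℝ (G i) y) (k : Fin n) :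
    partialDeriv k (fun z => ∑ i, F i z * G i z) y
      = ∑ i, F i y * partialDeriv k (G i) y + ∑ i, partialDeriv k (F i) y * G i y := by
  rw [partialDeriv_sum (fun i _ => (hF i).fun_mul (hG i)), ← Finset.sum_add_distrib]
  exact Finset.sum_congr rfl fun i _ => partialDeriv_mul (hF i) (hG i) k

/-- Mixed second partial derivatives of a `C²` function agree. -/
lemma partialDeriv_comm {F : EuclideanSpace ℝ (Fin n) → ℝ} (hF : ContDiffAt ℝ 2 F y)
    (i j : Fin n) :
    partialDeriv i (fun z => partialDeriv j F z) y
      = partialDeriv j (fun z => partialDeriv i F z) y := by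
  have hd : DifferentiableAt ℝ (fderiv ℝ F) y :=
    (hF.fderiv_right (m := 1) (by norm_num)).differentiableAt one_ne_zero
  have h : ∀ a b : Fin n, partialDeriv a (fun z => partialDeriv b F z) y
      = fderiv ℝ (fderiv ℝ F) y (EuclideanSpace.single a 1) (EuclideanSpace.single b 1) := by
    intro a b
    simp only [partialDeriv]
    rw [fderiv_clm_apply hd (differentiableAt_const _)]
    simp
  rw [h, h]
  exact (hF.isSymmSndFDerivAt (by simp)).eq _ _

lemma differentiableAt_partialDeriv {F : EuclideanSpace ℝ (Fin n) → ℝ} (hF : ContDiffAt ℝ 2 F y)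
    (i : Fin n) : DifferentiableAt ℝ (fun z => partialDeriv i F z) y :=
  ((hF.fderiv_right (m := 1) (by norm_num)).differentiableAt one_ne_zero).clm_apply
    (differentiableAt_const _)

lemma _root_.DifferentiableAt.matrix_det {E ι : Type*} [NormedAddCommGroup E] [NormedSpace ℝ E]
    [Fintype ι] [DecidableEq ι] {A : E → Matrix ι ι ℝ} {x : E}
    (hA : ∀ i j, DifferentiableAt ℝ (fun z => A z i j) x) :
    DifferentiableAt ℝ (fun z => (A z).det) x := by
  simp only [det_apply]
  exact DifferentiableAt.fun_sum fun σ _ =>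
    ((HasFDerivAt.finsetProd fun i _ => (hA (σ i) i).hasFDerivAt).differentiableAt).fun_const_smul _

/-- Cramer's rule: each entry is a determinant divided by `det A`. -/
lemma _root_.DifferentiableAt.matrix_inv {E ι : Type*} [NormedAddCommGroup E] [NormedSpace ℝ E]
    [Fintype ι] [DecidableEq ι] {A : E → Matrix ι ι ℝ} {x : E}
    (hA : ∀ i j, DifferentiableAt ℝ (fun z => A z i j) x) (hdet : IsUnit (A x).det) (i j : ι) :
    DifferentiableAt ℝ (fun z => (A z)⁻¹ i j) x := by
  simp only [inv_def, Ring.inverse_eq_inv', Matrix.smul_apply, smul_eq_mul]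
  refine ((DifferentiableAt.matrix_det hA).fun_inv hdet.ne_zero).fun_mul ?_
  simp only [adjugate_apply]
  refine DifferentiableAt.matrix_det fun a b => ?_
  by_cases h : a = j
  · subst h; simp
  · simpa [updateRow_ne h] using hA a b

end Calculus

/-! ### Covariant Hessian and metric compatibility in coordinates. -/

section Hessian

open Matrix Filter Topology

variable {n : ℕ} {M : Type*} [TopologicalSpace M] [ChartedSpace (EuclideanSpace ℝ (Fin n)) M]
  [Bundle.RiemannianBundle (fun x : M => TangentSpace (𝓡 n) x)]
  {φ : OpenPartialHomeomorph M (EuclideanSpace ℝ (Fin n))}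
  {f g : M → ℝ} {y : EuclideanSpace ℝ (Fin n)}

lemma metricMatrix_comm (z : EuclideanSpace ℝ (Fin n)) (i j : Fin n) :
    metricMatrix φ z i j = metricMatrix φ z j i :=
  real_inner_comm _ _

lemma metricMatrix_transpose (z : EuclideanSpace ℝ (Fin n)) :
    (metricMatrix φ z)ᵀ = metricMatrix φ z := by
  ext i j
  exact metricMatrix_comm z j i

lemma invMetric_comm (z : EuclideanSpace ℝ (Fin n)) (i j : Fin n) :
    invMetric φ z i j = invMetric φ z j i := by
  have : (invMetric φ z)ᵀ = invMetric φ z := by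
    rw [invMetric, transpose_nonsing_inv, metricMatrix_transpose]
  exact congrFun (congrFun this j) i

lemma christoffel_comm (k i j : Fin n) : christoffel φ y k i j = christoffel φ y k j i := by
  have : (fun z => metricMatrix φ z i j) = fun z => metricMatrix φ z j i :=
    funext fun z => metricMatrix_comm z i j
  simp only [christoffel]
  congr 1
  exact Finset.sum_congr rfl fun l _ => by rw [this]; ring

lemma d2_comm (hf : ContDiffAt ℝ 2 (f ∘ φ.symm) y) (i j : Fin n) :
    d2 φ f y i j = d2 φ f y j i := by
  simp only [d2, d1, christoffel_comm _ i j, partialDeriv_comm hf i j]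

lemma d1Up_eq_mulVec (z : EuclideanSpace ℝ (Fin n)) :
    d1Up φ f z = (metricMatrix φ z)⁻¹ *ᵥ d1 φ f z :=
  rfl

lemma metricMatrix_mulVec_d1Up {z : EuclideanSpace ℝ (Fin n)}
    (h : IsUnit (metricMatrix φ z).det) :
    metricMatrix φ z *ᵥ d1Up φ f z = d1 φ f z := by
  rw [d1Up_eq_mulVec, mulVec_mulVec, mul_nonsing_inv _ h, one_mulVec]

/-- The inverse metric inside the Christoffel symbol raises the index of `d1`, leaving only
derivatives of the metric. -/
lemma sum_christoffel_mul_d1 (i j : Fin n) :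
    ∑ k, christoffel φ y k i j * d1 φ f y k
      = 1 / 2 * ∑ l, d1Up φ f y l * (partialDeriv i (fun z => metricMatrix φ z j l) y
        + partialDeriv j (fun z => metricMatrix φ z i l) y
        - partialDeriv l (fun z => metricMatrix φ z i j) y) := by
  simp only [christoffel, d1Up, Finset.mul_sum, Finset.sum_mul]
  rw [Finset.sum_comm]
  refine Finset.sum_congr rfl fun l _ => Finset.sum_congr rfl fun k _ => ?_
  rw [invMetric_comm y k l]
  ring

/-- Metric compatibility of the Levi-Civita connection, for the pairing of two differentials:
`∂ₖ (fⁱ gᵢ) = gⁱ f_{ki} + fⁱ g_{ki}`. -/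
lemma partialDeriv_pairing (hS : ∀ i j, DifferentiableAt ℝ (fun z => metricMatrix φ z i j) y)
    (hdet : ∀ᶠ z in 𝓝 y, IsUnit (metricMatrix φ z).det)
    (hf : ∀ i, DifferentiableAt ℝ (fun z => d1 φ f z i) y)
    (hg : ∀ i, DifferentiableAt ℝ (fun z => d1 φ g z i) y) (k : Fin n) :
    partialDeriv k (fun z => ∑ i, d1Up φ f z i * d1 φ g z i) y
      = ∑ i, d1Up φ g y i * d2 φ f y k i + ∑ i, d1Up φ f y i * d2 φ g y k i := by
  have hup : ∀ {h : M → ℝ}, (∀ i, DifferentiableAt ℝ (fun z => d1 φ h z i) y) →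
      ∀ i, DifferentiableAt ℝ (fun z => d1Up φ h z i) y := fun hh i =>
    DifferentiableAt.fun_sum fun a _ =>
      (DifferentiableAt.matrix_inv hS hdet.self_of_nhds i a).fun_mul (hh a)
  -- Differentiating `h_i = g_{ij} h^j` avoids a formula for the derivative of the inverse metric.
  have hlow : ∀ {h : M → ℝ}, (∀ i, DifferentiableAt ℝ (fun z => d1 φ h z i) y) →
      ∀ i, partialDeriv k (fun z => d1 φ h z i) y
        = ∑ j, metricMatrix φ y i j * partialDeriv k (fun z => d1Up φ h z j) y
          + ∑ j, partialDeriv k (fun z => metricMatrix φ z i j) y * d1Up φ h y j := by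
    intro h hh i
    rw [← partialDeriv_sum_mul (hS i) (hup hh)]
    refine partialDeriv_congr ?_ k
    filter_upwards [hdet] with z hz
    exact (congrFun (metricMatrix_mulVec_d1Up (f := h) hz) i).symm
  rw [partialDeriv_sum_mul (hup hf) hg]
  have h₁ : ∑ i, partialDeriv k (fun z => d1Up φ f z i) y * d1 φ g y i
      = ∑ i, d1Up φ g y i * partialDeriv k (fun z => d1 φ f z i) y
        - ∑ i, ∑ j, d1Up φ g y i * d1Up φ f y j
          * partialDeriv k (fun z => metricMatrix φ z i j) y := by
    simp_rw [hlow hf, ← metricMatrix_mulVec_d1Up (f := g) hdet.self_of_nhds, mulVec, dotProduct,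
      mul_add, Finset.sum_add_distrib, Finset.mul_sum]
    rw [Finset.sum_comm]
    rw [eq_sub_iff_add_eq]
    congr 1
    · refine Finset.sum_congr rfl fun i _ => Finset.sum_congr rfl fun j _ => ?_
      rw [metricMatrix_comm y j i]
      ring
    · refine Finset.sum_congr rfl fun i _ => Finset.sum_congr rfl fun j _ => ?_
      ring
  -- After swapping the summation indices in the second sum, the last two metric derivatives of each
  -- symbol cancel in pairs and the two halves of `∂ₖ g_{ij}` add up.
  have h₂ : ∑ i, d1Up φ g y i * (∑ l, christoffel φ y l k i * d1 φ f y l)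
      + ∑ i, d1Up φ f y i * (∑ l, christoffel φ y l k i * d1 φ g y l)
      = ∑ i, ∑ j, d1Up φ g y i * d1Up φ f y j
          * partialDeriv k (fun z => metricMatrix φ z i j) y := by
    simp_rw [sum_christoffel_mul_d1, Finset.mul_sum]
    rw [Finset.sum_comm (f := fun i l => d1Up φ f y i * _), ← Finset.sum_add_distrib]
    refine Finset.sum_congr rfl fun i _ => ?_
    rw [← Finset.sum_add_distrib]
    refine Finset.sum_congr rfl fun j _ => ?_
    have : (fun z => metricMatrix φ z j i) = fun z => metricMatrix φ z i j :=
      funext fun z => metricMatrix_comm z j i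
    rw [this]
    ring
  rw [h₁]
  simp only [d2, mul_sub, Finset.sum_sub_distrib]
  linarith [h₂]

end Hessian

end RiemannianConjugate

namespace RiemannianConjugate

/-! ### Inner products from Gram matrices. -/

section Gram

open Matrix

/-- The inner product in terms of the components of the two vectors against a frame. -/
lemma inner_eq_sum_gram_inv {n : ℕ} {E : Type*} [NormedAddCommGroup E] [InnerProductSpace ℝ E]
    {v : Fin n → E} (hv : LinearIndependent ℝ v) {u : E} (hu : u ∈ Submodule.span ℝ (Set.range v))
    (w : E) :
    inner ℝ u w = ∑ i, ((gram ℝ v)⁻¹ *ᵥ fun j => inner ℝ u (v j)) i * inner ℝ w (v i) := by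
  obtain ⟨a, rfl⟩ := (Submodule.mem_span_range_iff_exists_fun ℝ).1 hu
  have hdet : IsUnit (gram ℝ v).det := (det_gram_ne_zero_iff_linearIndependent.2 hv).isUnit
  have h : (fun j => inner ℝ (∑ i, a i • v i) (v j)) = gram ℝ v *ᵥ a := by
    ext j
    simp only [sum_inner, real_inner_smul_left, mulVec, dotProduct, gram_apply]
    exact Finset.sum_congr rfl fun i _ => by rw [real_inner_comm, mul_comm]
  rw [h, mulVec_mulVec, nonsing_inv_mul _ hdet, one_mulVec, sum_inner]
  exact Finset.sum_congr rfl fun i _ => by rw [real_inner_smul_left, real_inner_comm]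

end Gram

/-! ### Coordinate frames and gradients in a chart. -/

section Charts

open Matrix Filter Topology

variable {n : ℕ} {M : Type*} [TopologicalSpace M] [ChartedSpace (EuclideanSpace ℝ (Fin n)) M]
  {φ : OpenPartialHomeomorph M (EuclideanSpace ℝ (Fin n))}
  {f g : M → ℝ} {y : EuclideanSpace ℝ (Fin n)}

lemma mdifferentiable_of_mem_maximalAtlas (hφ : φ ∈ IsManifold.maximalAtlas (𝓡 n) ∞ M) :
    φ.MDifferentiable (𝓡 n) (𝓡 n) :=
  ⟨(contMDiffOn_of_mem_maximalAtlas hφ).mdifferentiableOn (by simp),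
    (contMDiffOn_symm_of_mem_maximalAtlas hφ).mdifferentiableOn (by simp)⟩

lemma contDiffAt_comp_symm (hφ : φ ∈ IsManifold.maximalAtlas (𝓡 n) ∞ M)
    (hf : ContMDiff (𝓡 n) 𝓘(ℝ) ∞ f) (hy : y ∈ φ.target) : ContDiffAt ℝ ∞ (f ∘ φ.symm) y :=
  (hf.contMDiffAt.comp y ((contMDiffOn_symm_of_mem_maximalAtlas hφ).contMDiffAt
    (φ.open_target.mem_nhds hy))).contDiffAt

/-- The coordinate field is the tangent map of `φ.symm` applied to a constant field; this is what
makes the metric components differentiable. -/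
lemma contMDiffOn_coordVec [IsManifold (𝓡 n) ∞ M]
    (hφ : φ ∈ IsManifold.maximalAtlas (𝓡 n) ∞ M) (i : Fin n) :
    ContMDiffOn (𝓡 n) (𝓡 n).tangent ∞
      (fun z => (⟨φ.symm z, coordVec φ z i⟩ : TangentBundle (𝓡 n) M)) φ.target := by
  have hu : UniqueMDiffOn (𝓡 n) φ.target := φ.open_target.uniqueMDiffOn
  have h := (contMDiffOn_symm_of_mem_maximalAtlas hφ).contMDiffOn_tangentMapWithin
    (m := ∞) (by simp) hu
  have hs : ContMDiff (𝓡 n) (𝓡 n).tangent ∞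
      (fun z => (⟨z, stdVec z i⟩ : TangentBundle (𝓡 n) (EuclideanSpace ℝ (Fin n)))) := by
    intro z
    rw [Bundle.contMDiffAt_section]
    simpa [stdVec] using contMDiffAt_const
  refine (h.comp hs.contMDiffOn fun z hz => hz).congr fun z hz => ?_
  exact (tangentMapWithin_eq_tangentMap (hu z hz)
    ((mdifferentiable_of_mem_maximalAtlas hφ).mdifferentiableAt_symm hz)).symm

/-- The differential of `φ.symm` is an isomorphism, so it carries the standard basis to a basis. -/
lemma coordVec_basis (hφ : φ ∈ IsManifold.maximalAtlas (𝓡 n) ∞ M) (hy : y ∈ φ.target) :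
    LinearIndependent ℝ (coordVec φ y) ∧ ⊤ ≤ Submodule.span ℝ (Set.range (coordVec φ y)) := by
  let e := ((mdifferentiable_of_mem_maximalAtlas hφ).symm.mfderiv (x := y) hy).toLinearEquiv
  let b := (EuclideanSpace.basisFun (Fin n) ℝ).toBasis.map e
  have hb : ⇑b = coordVec φ y := by
    ext1 i
    have hi : (EuclideanSpace.basisFun (Fin n) ℝ).toBasis i = EuclideanSpace.single i 1 := by simp
    exact (Module.Basis.map_apply _ e i).trans (congrArg e hi)
  rw [← hb]
  exact ⟨b.linearIndependent, b.span_eq.ge⟩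

variable [Bundle.RiemannianBundle (fun x : M => TangentSpace (𝓡 n) x)]

lemma differentiableAt_metricMatrix [IsManifold (𝓡 n) ∞ M]
    [IsContMDiffRiemannianBundle (𝓡 n) ∞ (EuclideanSpace ℝ (Fin n))
      (fun x : M => TangentSpace (𝓡 n) x)]
    (hφ : φ ∈ IsManifold.maximalAtlas (𝓡 n) ∞ M) (hy : y ∈ φ.target) (i j : Fin n) :
    DifferentiableAt ℝ (fun z => metricMatrix φ z i j) y := by
  have h := ContMDiffOn.inner_bundle (contMDiffOn_coordVec hφ i) (contMDiffOn_coordVec hφ j)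
  exact ((h.contDiffOn).contDiffAt (φ.open_target.mem_nhds hy)).differentiableAt (by simp)

lemma posDef_metricMatrix (hφ : φ ∈ IsManifold.maximalAtlas (𝓡 n) ∞ M) (hy : y ∈ φ.target) :
    (metricMatrix φ y).PosDef := by
  exact posDef_gram_of_linearIndependent (coordVec_basis hφ hy).1

lemma d1_eq_inner_grad (hφ : φ ∈ IsManifold.maximalAtlas (𝓡 n) ∞ M)
    (hf : ContMDiff (𝓡 n) 𝓘(ℝ) ∞ f) (hy : y ∈ φ.target) (i : Fin n) :
    d1 φ f y i = inner ℝ (grad n f (φ.symm y)) (coordVec φ y i) := by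
  have h := mvfderiv_comp_apply (I := 𝓡 n) (I' := 𝓡 n) y (hf.mdifferentiableAt (by simp))
    ((mdifferentiable_of_mem_maximalAtlas hφ).mdifferentiableAt_symm hy) (stdVec y i)
  rw [grad, InnerProductSpace.toDual_symm_apply]
  refine Eq.trans ?_ h
  simp only [d1, partialDeriv, mvfderiv, mfderiv_eq_fderiv]
  rfl

/-- The inner product of two gradients in coordinates. -/
lemma inner_grad_eq (hφ : φ ∈ IsManifold.maximalAtlas (𝓡 n) ∞ M)
    (hf : ContMDiff (𝓡 n) 𝓘(ℝ) ∞ f) (hg : ContMDiff (𝓡 n) 𝓘(ℝ) ∞ g) (hy : y ∈ φ.target) :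
    inner ℝ (grad n f (φ.symm y)) (grad n g (φ.symm y)) = ∑ i, d1Up φ f y i * d1 φ g y i := by
  obtain ⟨hli, hspan⟩ := coordVec_basis hφ hy
  rw [inner_eq_sum_gram_inv hli (hspan Submodule.mem_top)]
  simp only [← d1_eq_inner_grad hφ hf hy, ← d1_eq_inner_grad hφ hg hy]
  rfl

end Charts

/-! ### Matrix form of `X` and the theorem. -/

section Conclusion

open Matrix Filter Topology

variable {n : ℕ} {M : Type*} [TopologicalSpace M] [ChartedSpace (EuclideanSpace ℝ (Fin n)) M]
  [Bundle.RiemannianBundle (fun x : M => TangentSpace (𝓡 n) x)]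
  {φ : OpenPartialHomeomorph M (EuclideanSpace ℝ (Fin n))}
  {f g : M → ℝ} {y : EuclideanSpace ℝ (Fin n)}

/-- Symmetry of the Hessian turns the full contraction `f^{jk} f_{jk}` into a trace. -/
lemma X_eq (hsymm : ∀ i j, d2 φ f y i j = d2 φ f y j i) (hdet : IsUnit (metricMatrix φ y).det) :
    X φ f y = 2 * ((Matrix.of (d2 φ f y) *ᵥ d1Up φ f y) ⬝ᵥ
        (metricMatrix φ y)⁻¹ *ᵥ (Matrix.of (d2 φ f y) *ᵥ d1Up φ f y))
      - (d1Up φ f y ⬝ᵥ metricMatrix φ y *ᵥ d1Up φ f y) *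
        ((metricMatrix φ y)⁻¹ * Matrix.of (d2 φ f y) * (metricMatrix φ y)⁻¹
          * Matrix.of (d2 φ f y)).trace
      + (d1Up φ f y ⬝ᵥ metricMatrix φ y *ᵥ d1Up φ f y) *
        (Matrix.of (d2 φ f y) * (metricMatrix φ y)⁻¹).trace ^ 2 := by
  have hmixed : Matrix.of (d2Mixed φ f y) = Matrix.of (d2 φ f y) * (metricMatrix φ y)⁻¹ := by
    ext i j; rfl
  have hup : Matrix.of (d2Up φ f y)
      = (metricMatrix φ y)⁻¹ * Matrix.of (d2 φ f y) * (metricMatrix φ y)⁻¹ := by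
    ext i j
    simp only [Matrix.of_apply, d2Up, mul_apply, Finset.sum_mul]
    exact Finset.sum_comm
  have h₁ : ∑ i, ∑ j, ∑ k, d2Mixed φ f y i j * d1 φ f y j * d2Up φ f y i k * d1 φ f y k
      = (Matrix.of (d2Mixed φ f y) *ᵥ d1 φ f y) ⬝ᵥ (Matrix.of (d2Up φ f y) *ᵥ d1 φ f y) := by
    simp only [mulVec, dotProduct, Matrix.of_apply, Finset.sum_mul_sum]
    exact Finset.sum_congr rfl fun i _ => Finset.sum_congr rfl fun j _ =>
      Finset.sum_congr rfl fun k _ => by ring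
  have h₂ : ∑ j, ∑ k, d2Up φ f y j k * d2 φ f y j k
      = (Matrix.of (d2Up φ f y) * Matrix.of (d2 φ f y)).trace := by
    simp only [trace, diag, mul_apply, Matrix.of_apply]
    exact Finset.sum_congr rfl fun j _ => Finset.sum_congr rfl fun k _ => by rw [hsymm j k]
  have h₃ : ∑ j, d2Mixed φ f y j j = (Matrix.of (d2Mixed φ f y)).trace := rfl
  have h₄ : ∑ i, d1Up φ f y i * d1 φ f y i = d1Up φ f y ⬝ᵥ metricMatrix φ y *ᵥ d1Up φ f y := by
    rw [metricMatrix_mulVec_d1Up hdet]; rfl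
  rw [X, h₁, h₂, h₃, h₄, hmixed, hup]
  simp only [← mulVec_mulVec, ← d1Up_eq_mulVec]

end Conclusion

end RiemannianConjugate

open RiemannianConjugate Matrix Filter Topology in
theorem mainTheorem2 {M : Type*} [TopologicalSpace M]
    [ChartedSpace (EuclideanSpace ℝ (Fin 3)) M] [IsManifold (𝓡 3) ∞ M]
    [Bundle.RiemannianBundle (fun x : M => TangentSpace (𝓡 3) x)]
    [IsContMDiffRiemannianBundle (𝓡 3) ∞ (EuclideanSpace ℝ (Fin 3))
      (fun x : M => TangentSpace (𝓡 3) x)]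
    (f : M → ℝ) (hf : ContMDiff (𝓡 3) 𝓘(ℝ) ∞ f)
    (hconj : ∃ g : M → ℝ, RiemannianConjugate.IsConjugate 3 f g)
    (p : M) (φ : OpenPartialHomeomorph M (EuclideanSpace ℝ (Fin 3)))
    (hφ : φ ∈ IsManifold.maximalAtlas (𝓡 3) ∞ M) (hp : p ∈ φ.source) :
    RiemannianConjugate.X φ f (φ p) ≤ 0 := by
  obtain ⟨g, -, hg, hnorm, horth⟩ := hconj
  set y := φ p
  have hy : y ∈ φ.target := φ.map_source hp
  have hdet : ∀ z ∈ φ.target, IsUnit (metricMatrix φ z).det := fun z hz =>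
    (posDef_metricMatrix hφ hz).det_pos.ne'.isUnit
  have hmem : ∀ᶠ z in 𝓝 y, z ∈ φ.target := φ.open_target.mem_nhds hy
  have hS := differentiableAt_metricMatrix hφ hy
  have hsmooth : ∀ {h : M → ℝ}, ContMDiff (𝓡 3) 𝓘(ℝ) ∞ h → ContDiffAt ℝ 2 (h ∘ φ.symm) y :=
    fun hh => (contDiffAt_comp_symm hφ hh hy).of_le ENat.LEInfty.out
  have hdf := fun i => differentiableAt_partialDeriv (hsmooth hf) i
  have hdg := fun i => differentiableAt_partialDeriv (hsmooth hg) i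
  have hpair := fun {h₁ h₂ : M → ℝ} (hd₁ : ∀ i, DifferentiableAt ℝ (fun z => d1 φ h₁ z i) y)
    (hd₂ : ∀ i, DifferentiableAt ℝ (fun z => d1 φ h₂ z i) y) =>
    partialDeriv_pairing hS (hmem.mono hdet) hd₁ hd₂
  have hnorm' : ∀ z ∈ φ.target, ∑ i, d1Up φ f z i * d1 φ f z i
      = ∑ i, d1Up φ g z i * d1 φ g z i := fun z hz => by
    rw [← inner_grad_eq hφ hf hf hz, ← inner_grad_eq hφ hg hg hz, real_inner_self_eq_norm_sq,
      real_inner_self_eq_norm_sq, hnorm]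
  have horth' : ∀ z ∈ φ.target, ∑ i, d1Up φ f z i * d1 φ g z i = 0 := fun z hz => by
    rw [← inner_grad_eq hφ hf hg hz, horth]
  -- Derivative of the equal-length condition, which holds on all of `φ.target`, a neighbourhood of
  -- `y`.
  have h₁ : Matrix.of (d2 φ f y) *ᵥ d1Up φ f y = Matrix.of (d2 φ g y) *ᵥ d1Up φ g y := by
    ext k
    have h := partialDeriv_congr (hmem.mono hnorm') k
    rw [hpair hdf hdf, hpair hdg hdg] at h
    simp only [mulVec, dotProduct, Matrix.of_apply, mul_comm (d2 _ _ _ _ _)]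
    linarith
  -- Derivative of the orthogonality condition.
  have h₂ : Matrix.of (d2 φ f y) *ᵥ d1Up φ g y = -(Matrix.of (d2 φ g y) *ᵥ d1Up φ f y) := by
    ext k
    have h := partialDeriv_congr (hmem.mono horth') k
    rw [hpair hdf hdg, show partialDeriv k (fun _ => (0 : ℝ)) y = 0 by simp [partialDeriv]] at h
    simp only [mulVec, dotProduct, Matrix.of_apply, Pi.neg_apply, mul_comm (d2 _ _ _ _ _)]
    linarith
  have hsymm : ∀ {h : M → ℝ}, ContMDiff (𝓡 3) 𝓘(ℝ) ∞ h →
      (Matrix.of (d2 φ h y))ᵀ = Matrix.of (d2 φ h y) := fun hh => by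
    ext i j
    exact d2_comm (hsmooth hh) j i
  rw [X_eq (d2_comm (hsmooth hf)) (hdet y hy)]
  refine conjugate_quadratic_nonpos (posDef_metricMatrix hφ hy) (hsymm hf) (hsymm hg) ?_ ?_ h₁ h₂
  · rw [metricMatrix_mulVec_d1Up (hdet y hy)]
    exact horth' y hy
  · rw [metricMatrix_mulVec_d1Up (hdet y hy), metricMatrix_mulVec_d1Up (hdet y hy)]
    exact (hnorm' y hy).symm
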